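/- Let $\Lambda=\mathbb Z[t,t^{-1}]$. A diagram $D$ of an oriented virtual knot is an oriented, closed, piecewise smooth plane curve whose only self-intersections are finitely many transverse double points (crossings); some of the crossings are classical, which means that one of the two strands is marked as overpassing and the other one as underpassing, and the remaining crossings are virtual. Cutting the curve at the underpass of every classical crossing (and nowhere else) divides it into arcs; let $A(D)$ be the set of arcs and $C(D)$ the set of classical crossings. For $c\in C(D)$, let $a(c)$ be the overpassing arc, and let $b_1(c)$ and $b_2(c)$ be the underpassing arcs on the right and on the left side, respectively, of the oriented arc $a(c)$. A medial quandle is a set with an operation $\triangleright$ such that $x\triangleright x=x$ for all $x$, every map $x\mapsto x\triangleright y$ is a bijection, and $(w\triangleright x)\triangleright(y\triangleright z)=(w\triangleright y)\triangleright(x\triangleright z)$ for all $w,x,y,z$. For a virtual knot $L$ with diagram $D$: - $\mathrm{MQ}(L)$ is the medial quandle with generators $q_a$ $(a\in A(D))$ and relations $q_{b_2(c)}=q_{b_1(c)}\triangleright q_{a(c)}$ $(c\in C(D))$; - $M_A^{\mathrm{red}}(L)$ is the $\Lambda$-module with generators $A(D)$ and relations $(1-t)a(c)+t\,b_1(c)-b_2(c)=0$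 $(c\in C(D))$, and $\phi_L^{\mathrm{red}}:M_A^{\mathrm{red}}(L)\to\Lambda$ is the $\Lambda$-linear map that sends the generator of every arc to $1$. Then the following hold, for all virtual knots (classical ones included) and all choices of diagrams of them. 1. For every virtual knot $L$, the quandle $\mathrm{MQ}(L)$ is isomorphic to the standard Alexander quandle on the $\Lambda$-module $\ker\phi_L^{\mathrm{red}}$, that is, to the set $\ker\phi_L^{\mathrm{red}}$ with the operation $x\triangleright y=tx+(1-t)y$. 2. $\mathrm{MQ}(L)$ and $\ker\phi_L^{\mathrm{red}}$ determine each other: for all virtual knots $L$ and $L'$, the quandles $\mathrm{MQ}(L)$ and $\mathrm{MQ}(L')$ are isomorphic if and only if the $\Lambda$-modules $\ker\phi_L^{\mathrm{red}}$ and $\ker\phi_{L'}^{\mathrm{red}}$ are isomorphic. -/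

import Mathlib

open scoped ContDiff

/-! ### Medial quandles

The right-handed operation `x ▷ y` of a quandle is Mathlib's `Shelf.act y x`, and `x ▷⁻¹ y` is
`Rack.invAct y x`; the translation `β_y` is `Shelf.act y`. -/

/-- A quandle is medial if `(w ▷ x) ▷ (y ▷ z) = (w ▷ y) ▷ (x ▷ z)` for all `w, x, y, z`. -/
def Quandle.IsMedial (Q : Type*) [Quandle Q] : Prop :=
  ∀ w x y z : Q, Shelf.act (Shelf.act z y) (Shelf.act x w) =
    Shelf.act (Shelf.act z x) (Shelf.act y w)

/-- Two quandles are isomorphic if there is a bijective quandle homomorphism between them. -/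
def Quandle.Isomorphic (Q Q' : Type*) [Quandle Q] [Quandle Q'] : Prop :=
  ∃ f : ShelfHom Q Q', Function.Bijective f

namespace MedialQuandle

/-- Formal expressions in generators `A` and the operations `▷` and `▷⁻¹`. -/
inductive Term (A : Type*) where
  | gen (a : A) : Term A
  | op (x y : Term A) : Term A
  | inv (x y : Term A) : Term A

/-- The least congruence on expressions that contains the relations `rels` and satisfies the
axioms of a medial quandle. -/
inductive Congruence {A : Type*} (rels : Term A → Term A → Prop) : Term A → Term A → Prop where
  | rel {x y : Term A} (h : rels x y) : Congruence rels x y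
  | refl (x : Term A) : Congruence rels x x
  | symm {x y : Term A} (h : Congruence rels x y) : Congruence rels y x
  | trans {x y z : Term A} (h : Congruence rels x y) (k : Congruence rels y z) :
      Congruence rels x z
  | op_congr {x x' y y' : Term A} (h : Congruence rels x x') (k : Congruence rels y y') :
      Congruence rels (.op x y) (.op x' y')
  | inv_congr {x x' y y' : Term A} (h : Congruence rels x x') (k : Congruence rels y y') :
      Congruence rels (.inv x y) (.inv x' y')
  | idem (x : Term A) : Congruence rels (.op x x) x
  | inv_op (x y : Term A) : Congruence rels (.inv (.op x y) y) x
  | op_inv (x y : Term A) : Congruence rels (.op (.inv x y) y) x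
  | medial (w x y z : Term A) :
      Congruence rels (.op (.op w x) (.op y z)) (.op (.op w y) (.op x z))

/-- The setoid of the congruence. -/
def congruenceSetoid {A : Type*} (rels : Term A → Term A → Prop) : Setoid (Term A) where
  r := Congruence rels
  iseqv := ⟨.refl, .symm, .trans⟩

/-- The medial quandle with generators `A` and relations `rels`. -/
def Presented {A : Type*} (rels : Term A → Term A → Prop) : Type _ :=
  Quotient (congruenceSetoid rels)

/-- The class of an expression in the presented medial quandle. -/
def Presented.mk {A : Type*} (rels : Term A → Term A → Prop) (x : Term A) : Presented rels :=
  Quotient.mk (congruenceSetoid rels) x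

instance Presented.instQuandle {A : Type*} (rels : Term A → Term A → Prop) :
    Quandle (Presented rels) where
  act y x := Quotient.map₂ (sa := congruenceSetoid rels) (sb := congruenceSetoid rels)
    (sc := congruenceSetoid rels) Term.op (fun _ _ h _ _ k => .op_congr h k) x y
  invAct y x := Quotient.map₂ (sa := congruenceSetoid rels) (sb := congruenceSetoid rels)
    (sc := congruenceSetoid rels) Term.inv (fun _ _ h _ _ k => .inv_congr h k) x y
  self_distrib := by
    rintro ⟨z⟩ ⟨y⟩ ⟨x⟩
    exact Quotient.sound (s := congruenceSetoid rels)
      (.trans (.op_congr (.refl _) (.symm (.idem z))) (.medial x y z z))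
  left_inv := by
    rintro ⟨y⟩ ⟨x⟩
    exact Quotient.sound (s := congruenceSetoid rels) (.inv_op x y)
  right_inv := by
    rintro ⟨y⟩ ⟨x⟩
    exact Quotient.sound (s := congruenceSetoid rels) (.op_inv x y)
  fix := by
    rintro ⟨x⟩
    exact Quotient.sound (s := congruenceSetoid rels) (.idem x)

theorem Presented.isMedial {A : Type*} (rels : Term A → Term A → Prop) :
    Quandle.IsMedial (Presented rels) := by
  rintro ⟨w⟩ ⟨x⟩ ⟨y⟩ ⟨z⟩
  exact Quotient.sound (s := congruenceSetoid rels) (.medial w x y z)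

end MedialQuandle

/-! ### Laurent polynomials and standard Alexander quandles -/

/-- The ring `ℤ[t, t⁻¹]` of integer Laurent polynomials; the variable `t` is
`LaurentPolynomial.T 1`. -/
abbrev LaurentRing : Type := LaurentPolynomial ℤ

/-- The standard Alexander quandle on a module `N` over the Laurent polynomials: the set `N` with
`x ▷ y = t x + (1 - t) y`. -/
def AlexanderQuandle (N : Type*) : Type _ := N

namespace AlexanderQuandle

/-- The operation `x ▷ y = t x + (1 - t) y`. -/
noncomputable def op {N : Type*} [AddCommGroup N] [Module LaurentRing N] (x y : N) : N :=
  (LaurentPolynomial.T 1 : LaurentRing) • x + (1 - LaurentPolynomial.T 1 : LaurentRing) • y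

/-- The inverse operation `x ▷⁻¹ y = t⁻¹ x + (1 - t⁻¹) y`. -/
noncomputable def inv {N : Type*} [AddCommGroup N] [Module LaurentRing N] (x y : N) : N :=
  (LaurentPolynomial.T (-1) : LaurentRing) • x + (1 - LaurentPolynomial.T (-1) : LaurentRing) • y

theorem inv_op {N : Type*} [AddCommGroup N] [Module LaurentRing N] (x y : N) :
    inv (op x y) y = x := by
  have h : (LaurentPolynomial.T (-1) : LaurentRing) * LaurentPolynomial.T 1 = 1 := by
    rw [← LaurentPolynomial.T_add]; simp
  unfold op inv
  rw [smul_add, smul_smul, smul_smul, mul_sub, h]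
  module

theorem op_inv {N : Type*} [AddCommGroup N] [Module LaurentRing N] (x y : N) :
    op (inv x y) y = x := by
  have h : (LaurentPolynomial.T 1 : LaurentRing) * LaurentPolynomial.T (-1) = 1 := by
    rw [← LaurentPolynomial.T_add]; simp
  unfold op inv
  rw [smul_add, smul_smul, smul_smul, mul_sub, h]
  module

theorem op_self {N : Type*} [AddCommGroup N] [Module LaurentRing N] (x : N) : op x x = x := by
  unfold op
  module

theorem op_distrib {N : Type*} [AddCommGroup N] [Module LaurentRing N] (x y z : N) :
    op (op x y) z = op (op x z) (op y z) := by
  unfold op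
  module

noncomputable instance instQuandle (N : Type*) [AddCommGroup N] [Module LaurentRing N] :
    Quandle (AlexanderQuandle N) where
  act y x := op (N := N) x y
  invAct y x := inv (N := N) x y
  self_distrib := by
    intro z y x
    exact op_distrib (N := N) x y z
  left_inv := fun y x => inv_op (N := N) x y
  right_inv := fun y x => op_inv (N := N) x y
  fix := by
    intro x
    exact op_self (N := N) x

end AlexanderQuandle

/-! ### Diagrams of oriented virtual links -/

/-- The parameter space of `μ` closed curves: `μ` disjoint oriented circles. -/
abbrev CurveParam (μ : ℕ) : Type := Fin μ × UnitAddCircle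

namespace CurveParam

/-- Move the parameter `p` by `x` along its circle, in the positive direction if `0 < x`. -/
def shift {μ : ℕ} (p : CurveParam μ) (x : ℝ) : CurveParam μ := (p.1, p.2 + (x : UnitAddCircle))

/-- The velocity vector at the parameter `p` of curves `γ` in the plane. -/
noncomputable def velocity {μ : ℕ} (γ : CurveParam μ → ℝ × ℝ) (p : CurveParam μ) : ℝ × ℝ :=
  deriv (fun x : ℝ => γ (p.shift x)) 0

end CurveParam

/-- The determinant of two plane vectors. It is positive if and only if `w` points to the left of
the directed line spanned by `v`. -/
def planeDet (v w : ℝ × ℝ) : ℝ := v.1 * w.2 - v.2 * w.1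

/-- A diagram of an oriented virtual link with `μ` components. -/
structure VirtualLinkDiagram (μ : ℕ) where
  /-- The `μ` closed oriented curves in the plane. -/
  curve : CurveParam μ → ℝ × ℝ
  /-- The curves are piecewise smooth. (Each circle is compact, so this local condition says that
  it is a finite union of closed intervals on each of which the curve is smooth.) -/
  piecewiseSmooth : ∀ p : CurveParam μ, ∃ ε > 0,
    ContDiffOn ℝ ∞ (fun x : ℝ => curve (p.shift x)) (Set.Icc (-ε) 0) ∧
    ContDiffOn ℝ ∞ (fun x : ℝ => curve (p.shift x)) (Set.Icc 0 ε)
  /-- There are finitely many crossings. -/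
  finite_crossings : {z : ℝ × ℝ | ∃ p q, p ≠ q ∧ curve p = z ∧ curve q = z}.Finite
  /-- Only two strands meet at a crossing. -/
  no_triple : ∀ p q r, p ≠ q → p ≠ r → q ≠ r → ¬ (curve p = curve q ∧ curve p = curve r)
  /-- The two strands at a crossing are differentiable there and meet transversely: a velocity
  that does not exist counts as `0`, which is excluded. -/
  transverse : ∀ p q, p ≠ q → curve p = curve q →
    planeDet (CurveParam.velocity curve p) (CurveParam.velocity curve q) ≠ 0
  /-- The classical crossings; all the other crossings are virtual. -/
  classical : Set (ℝ × ℝ)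
  /-- The parameter at which the overpassing strand runs through a classical crossing. -/
  overParam : classical → CurveParam μ
  /-- The parameter at which the underpassing strand runs through a classical crossing. -/
  underParam : classical → CurveParam μ
  over_ne_under : ∀ c, overParam c ≠ underParam c
  curve_over : ∀ c, curve (overParam c) = c
  curve_under : ∀ c, curve (underParam c) = c

/-- A diagram of an oriented virtual knot is a diagram with one component. -/
abbrev VirtualKnotDiagram : Type := VirtualLinkDiagram 1

namespace VirtualLinkDiagram

/-- The type `C(D)` of classical crossings. -/
abbrev Crossing {μ : ℕ} (D : VirtualLinkDiagram μ) : Type := D.classical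

/-- The parameters that remain when the curves are cut at every underpass of a classical
crossing. -/
abbrev CutParam {μ : ℕ} (D : VirtualLinkDiagram μ) : Type :=
  {p : CurveParam μ // p ∉ Set.range D.underParam}

/-- The type `A(D)` of (long) arcs: the pieces into which the curves fall when they are cut at
every underpass of a classical crossing. Nothing is cut at a virtual crossing or an overpass. -/
abbrev Arc {μ : ℕ} (D : VirtualLinkDiagram μ) : Type := ConnectedComponents D.CutParam

theorem over_not_mem_range_under {μ : ℕ} (D : VirtualLinkDiagram μ) (c : D.Crossing) :
    D.overParam c ∉ Set.range D.underParam := by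
  rintro ⟨c', h⟩
  have e : c' = c := Subtype.ext (by rw [← D.curve_under c', h, D.curve_over c])
  subst e
  exact D.over_ne_under c' h.symm

theorem finite_classical {μ : ℕ} (D : VirtualLinkDiagram μ) : D.classical.Finite :=
  D.finite_crossings.subset fun z hz =>
    ⟨D.overParam ⟨z, hz⟩, D.underParam ⟨z, hz⟩, D.over_ne_under _, D.curve_over _, D.curve_under _⟩

theorem exists_forall_shift_not_mem {μ : ℕ} (D : VirtualLinkDiagram μ) (p : CurveParam μ) :
    ∃ ε > 0, ∀ x : ℝ, x ≠ 0 → |x| < ε → p.shift x ∉ Set.range D.underParam := by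
  have hfin : (Set.range D.underParam \ {p}).Finite := by
    have : Finite D.Crossing := D.finite_classical
    exact (Set.finite_range D.underParam).subset Set.sdiff_subset
  have hcont : Continuous fun x : ℝ => p.shift x := by
    unfold CurveParam.shift
    exact continuous_const.prodMk (continuous_const.add (AddCircle.continuous_mk' 1))
  have hopen : IsOpen ((fun x : ℝ => p.shift x) ⁻¹' (Set.range D.underParam \ {p})ᶜ) :=
    hfin.isClosed.isOpen_compl.preimage hcont
  have h0 : (0 : ℝ) ∈ (fun x : ℝ => p.shift x) ⁻¹' (Set.range D.underParam \ {p})ᶜ := by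
    simp [CurveParam.shift]
  obtain ⟨ε, hε, hball⟩ := Metric.isOpen_iff.1 hopen 0 h0
  refine ⟨min ε 1, lt_min hε one_pos, fun x hx hlt hmem => ?_⟩
  have hx' := hball (show x ∈ Metric.ball (0 : ℝ) ε by
    simpa using hlt.trans_le (min_le_left _ _))
  refine hx' ⟨hmem, fun hp => ?_⟩
  have h2 : (x : UnitAddCircle) = 0 := by
    have := congrArg Prod.snd hp
    simpa [CurveParam.shift] using this
  obtain ⟨n, hn⟩ := (AddCircle.coe_eq_zero_iff (1 : ℝ)).1 h2
  have hn' : x = (n : ℝ) := by simpa using hn.symm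
  have h1 : |(n : ℝ)| < 1 := hn' ▸ hlt.trans_le (min_le_right _ _)
  have h3 : |n| < 1 := by exact_mod_cast h1
  rw [Int.abs_lt_one_iff] at h3
  exact hx (by simp [hn', h3])

theorem exists_arc_of_isPreconnected {μ : ℕ} (D : VirtualLinkDiagram μ) (p : CurveParam μ)
    (s : Set ℝ) (hs : IsPreconnected s) (hne : s.Nonempty)
    (h : ∀ x ∈ s, p.shift x ∉ Set.range D.underParam) :
    ∃ a : D.Arc, ∀ x ∈ s, ∃ hx : p.shift x ∉ Set.range D.underParam,
      (ConnectedComponents.mk (⟨p.shift x, hx⟩ : D.CutParam)) = a := by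
  obtain ⟨y, hy⟩ := hne
  have hcont : Continuous fun x : s => (⟨p.shift x, h x x.2⟩ : D.CutParam) := by
    refine Continuous.subtype_mk ?_ _
    unfold CurveParam.shift
    exact continuous_const.prodMk
      (continuous_const.add ((AddCircle.continuous_mk' 1).comp continuous_subtype_val))
  have hpre : IsPreconnected (Set.range fun x : s => (⟨p.shift x, h x x.2⟩ : D.CutParam)) := by
    have : PreconnectedSpace s := isPreconnected_iff_preconnectedSpace.1 hs
    exact isPreconnected_range hcont
  refine ⟨ConnectedComponents.mk ⟨p.shift y, h y hy⟩, fun x hx => ⟨h x hx, ?_⟩⟩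
  exact ConnectedComponents.coe_eq_coe'.2
    (hpre.subset_connectedComponent ⟨⟨y, hy⟩, rfl⟩ ⟨⟨x, hx⟩, rfl⟩)

theorem exists_arcBefore {μ : ℕ} (D : VirtualLinkDiagram μ) (p : CurveParam μ) :
    ∃ a : D.Arc, ∀ᶠ x in nhdsWithin (0 : ℝ) (Set.Iio 0), ∃ h : p.shift x ∉ Set.range D.underParam,
      (ConnectedComponents.mk (⟨p.shift x, h⟩ : D.CutParam)) = a := by
  obtain ⟨ε, hε, h⟩ := D.exists_forall_shift_not_mem p
  obtain ⟨a, ha⟩ := D.exists_arc_of_isPreconnected p (Set.Ioo (-ε) 0) isPreconnected_Ioo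
    (Set.nonempty_Ioo.2 (by linarith))
    (fun x hx => h x hx.2.ne (abs_lt.2 ⟨hx.1, hx.2.trans hε⟩))
  exact ⟨a, Filter.mem_of_superset (Ioo_mem_nhdsLT (by linarith)) ha⟩

theorem exists_arcAfter {μ : ℕ} (D : VirtualLinkDiagram μ) (p : CurveParam μ) :
    ∃ a : D.Arc, ∀ᶠ x in nhdsWithin (0 : ℝ) (Set.Ioi 0), ∃ h : p.shift x ∉ Set.range D.underParam,
      (ConnectedComponents.mk (⟨p.shift x, h⟩ : D.CutParam)) = a := by
  obtain ⟨ε, hε, h⟩ := D.exists_forall_shift_not_mem p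
  obtain ⟨a, ha⟩ := D.exists_arc_of_isPreconnected p (Set.Ioo 0 ε) isPreconnected_Ioo
    (Set.nonempty_Ioo.2 hε)
    (fun x hx => h x hx.1.ne' (abs_lt.2 ⟨by linarith [hx.1], hx.2⟩))
  exact ⟨a, Filter.mem_of_superset (Ioo_mem_nhdsGT hε) ha⟩

/-- The overpassing arc `a(c)` of a classical crossing. -/
def overArc {μ : ℕ} (D : VirtualLinkDiagram μ) (c : D.Crossing) : D.Arc :=
  ConnectedComponents.mk ⟨D.overParam c, D.over_not_mem_range_under c⟩

/-- The arc on which the underpassing strand arrives at the classical crossing `c`. -/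
noncomputable def arcBefore {μ : ℕ} (D : VirtualLinkDiagram μ) (c : D.Crossing) : D.Arc :=
  (D.exists_arcBefore (D.underParam c)).choose

/-- The arc on which the underpassing strand leaves the classical crossing `c`. -/
noncomputable def arcAfter {μ : ℕ} (D : VirtualLinkDiagram μ) (c : D.Crossing) : D.Arc :=
  (D.exists_arcAfter (D.underParam c)).choose

/-- The underpassing strand crosses the overpassing strand from its right to its left. -/
def UnderFromRight {μ : ℕ} (D : VirtualLinkDiagram μ) (c : D.Crossing) : Prop :=
  0 < planeDet (CurveParam.velocity D.curve (D.overParam c)) (CurveParam.velocity D.curve (D.underParam c))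

open Classical in
/-- The underpassing arc `b₁(c)` on the right side of the overpassing arc. -/
noncomputable def rightArc {μ : ℕ} (D : VirtualLinkDiagram μ) (c : D.Crossing) : D.Arc :=
  if D.UnderFromRight c then D.arcBefore c else D.arcAfter c

open Classical in
/-- The underpassing arc `b₂(c)` on the left side of the overpassing arc. -/
noncomputable def leftArc {μ : ℕ} (D : VirtualLinkDiagram μ) (c : D.Crossing) : D.Arc :=
  if D.UnderFromRight c then D.arcAfter c else D.arcBefore c

/-! ### The medial quandle and the reduced Alexander module -/

/-- The relations `b₂(c) = b₁(c) ▷ a(c)`, one for each classical crossing `c`. -/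
def CrossingRelation {μ : ℕ} (D : VirtualLinkDiagram μ) (x y : MedialQuandle.Term D.Arc) : Prop :=
  ∃ c : D.Crossing, x = .gen (D.leftArc c) ∧ y = .op (.gen (D.rightArc c)) (.gen (D.overArc c))

/-- The medial quandle `MQ(L)` of the link with diagram `D`: generated by the arcs, with the
crossing relations. -/
abbrev MQ {μ : ℕ} (D : VirtualLinkDiagram μ) : Type :=
  MedialQuandle.Presented D.CrossingRelation

/-- The map `ϱ_D` from the free module on the classical crossings to the free module on the arcs,
`c ↦ (1 - t) a(c) + t b₁(c) - b₂(c)`. -/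
noncomputable def crossingMap {μ : ℕ} (D : VirtualLinkDiagram μ) :
    (D.Crossing →₀ LaurentRing) →ₗ[LaurentRing] (D.Arc →₀ LaurentRing) :=
  Finsupp.linearCombination LaurentRing fun c =>
    (1 - LaurentPolynomial.T 1 : LaurentRing) • Finsupp.single (D.overArc c) 1 +
      (LaurentPolynomial.T 1 : LaurentRing) • Finsupp.single (D.rightArc c) 1 -
      Finsupp.single (D.leftArc c) 1

/-- The reduced Alexander module, the cokernel of `ϱ_D`. -/
abbrev ReducedAlexanderModule {μ : ℕ} (D : VirtualLinkDiagram μ) : Type :=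
  (D.Arc →₀ LaurentRing) ⧸ LinearMap.range D.crossingMap

theorem range_crossingMap_le {μ : ℕ} (D : VirtualLinkDiagram μ) :
    LinearMap.range D.crossingMap ≤
      LinearMap.ker (Finsupp.linearCombination LaurentRing fun _ : D.Arc => (1 : LaurentRing)) := by
  rw [LinearMap.range_le_ker_iff]
  ext c
  simp [crossingMap]

/-- The linear map `φ_L^red` from the reduced Alexander module to the Laurent polynomials that
sends the generator of every arc to `1`. -/
noncomputable def phiRed {μ : ℕ} (D : VirtualLinkDiagram μ) :
    D.ReducedAlexanderModule →ₗ[LaurentRing] LaurentRing :=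
  (LinearMap.range D.crossingMap).liftQ
    (Finsupp.linearCombination LaurentRing fun _ : D.Arc => (1 : LaurentRing))
    D.range_crossingMap_le

/-- The reduced Alexander invariant `ker φ_L^red`. -/
abbrev AlexanderInvariant {μ : ℕ} (D : VirtualLinkDiagram μ) : Type :=
  LinearMap.ker D.phiRed

end VirtualLinkDiagram

/-! The idea is that the medial quandle of a knot is connected, and that connected medial quandles
are Alexander quandles. Write `β_y` for the translation `x ↦ x ▷ y`. Mediality makes the group
generated by the quotients `β_x β_y⁻¹` abelian. If this group is transitive, then it acts simply
transitively, so a base point `q` identifies the quandle with the group, and conjugation by `β_q`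
becomes multiplication by `t` (`Quandle.IsMedial.exists_alexander`). For a knot it is transitive on
`MQ`, because the two arcs at an underpass lie in one orbit and a walk along the knot meets every
arc.

Thus `MQ` is the Alexander quandle of some module `N`. The two presentations give a quandle map from
`MQ` to the kernel of `φ` and a linear map from this kernel to `N`. That they are mutually inverse,
up to the identification of `MQ` with `N`, is checked on generators. This needs linearity of a map
known only to preserve `▷`, which follows from surjectivity of `1 - t`: every sum `x + y` then has
the form `t x' + (1 - t) y'`. Modulo `1 - t` a crossing relation identifies the two underpassing
arcs, so `1 - t` is surjective on the kernel for a knot. The same linearity argument recovers the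
module from the quandle and gives the second claim. -/

/-! ### Modules over the Laurent polynomials -/

open LaurentPolynomial in
/-- An additive map between modules over the Laurent polynomials that commutes with `t` is
linear. -/
theorem AddMonoidHom.map_laurent_smul {N N' : Type*} [AddCommGroup N] [Module LaurentRing N]
    [AddCommGroup N'] [Module LaurentRing N'] (f : N →+ N')
    (hf : ∀ x, f ((T 1 : LaurentRing) • x) = (T 1 : LaurentRing) • f x) (r : LaurentRing) (x : N) :
    f (r • x) = r • f x := by
  have hinv : ∀ x, f ((T (-1) : LaurentRing) • x) = (T (-1) : LaurentRing) • f x := by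
    intro x
    have h := hf ((T (-1) : LaurentRing) • x)
    rw [smul_smul, ← T_add] at h
    rw [show (1 : ℤ) + -1 = 0 from rfl, T_zero, one_smul] at h
    rw [h, smul_smul, ← T_add]
    simp
  have hT : ∀ (n : ℤ) (x : N), f ((T n : LaurentRing) • x) = (T n : LaurentRing) • f x := by
    intro n
    induction n using Int.induction_on with
    | zero => simp
    | succ n ih => intro x; rw [T_add, mul_smul, ih, hf, mul_smul]
    | pred n ih => intro x; rw [sub_eq_add_neg, T_add, mul_smul, ih, hinv, mul_smul]
  induction r using LaurentPolynomial.induction_on' with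
  | add p q hp hq => rw [add_smul, map_add, hp, hq, add_smul]
  | C_mul_T n a =>
    have hC : (C a : LaurentRing) = (a : LaurentRing) := by simp
    rw [hC, mul_smul, mul_smul, Int.cast_smul_eq_zsmul, map_zsmul, hT, Int.cast_smul_eq_zsmul]

/-- The module over the Laurent polynomials on which `t` acts by a given automorphism. -/
noncomputable abbrev LaurentRing.moduleOfUnit {N : Type*} [AddCommGroup N]
    (e : (AddMonoid.End N)ˣ) : Module LaurentRing N :=
  -- The Laurent polynomials are the group ring of `ℤ`, so the powers of `e` define a ring
  -- homomorphism to the endomorphisms.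
  Module.compHom N (AddMonoidAlgebra.lift ℤ (AddMonoid.End N) ℤ
    ((Units.coeHom _).comp (zpowersHom _ e))).toRingHom

theorem LaurentRing.moduleOfUnit_T_smul {N : Type*} [AddCommGroup N] (e : (AddMonoid.End N)ˣ)
    (x : N) :
    letI := LaurentRing.moduleOfUnit e
    (LaurentPolynomial.T 1 : LaurentRing) • x = (e : AddMonoid.End N) x := by
  change (AddMonoidAlgebra.lift ℤ (AddMonoid.End N) ℤ
    ((Units.coeHom _).comp (zpowersHom _ e))) (AddMonoidAlgebra.single 1 1) x = _
  rw [AddMonoidAlgebra.lift_single]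
  simp

/-! ### The displacement group and connected medial quandles -/

namespace Quandle

/-- The displacement group of a quandle, generated by the quotients of two translations. -/
def displacement (Q : Type*) [Quandle Q] : Subgroup (Equiv.Perm Q) :=
  Subgroup.closure {g | ∃ x y : Q, g = Rack.act' x * (Rack.act' y)⁻¹}

/-- Mediality, read as an equality of permutations, becomes this exchange of outer factors once
`β_{x ▷ y} = β_y β_x β_y⁻¹` is inserted and the common left factor is cancelled. -/
theorem IsMedial.act'_mul_inv_mul {Q : Type*} [Quandle Q] (hQ : IsMedial Q) (x y z : Q) :
    (Rack.act' x * (Rack.act' y)⁻¹ * Rack.act' z : Equiv.Perm Q) =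
      Rack.act' z * (Rack.act' y)⁻¹ * Rack.act' x := by
  have h : (Rack.act' (Shelf.act y x) * Rack.act' z : Equiv.Perm Q) =
      Rack.act' (Shelf.act y z) * Rack.act' x := by
    ext w
    exact hQ w z x y
  rw [Rack.ad_conj, Rack.ad_conj] at h
  simpa [mul_assoc] using h

/-- Two generators commute by exchanging outer factors twice, the second time in inverted form: `x
y⁻¹ z w⁻¹ = z y⁻¹ x w⁻¹ = z w⁻¹ x y⁻¹`, with letters standing for translations. -/
theorem IsMedial.displacement_comm {Q : Type*} [Quandle Q] (hQ : IsMedial Q) :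
    IsMulCommutative (displacement Q) := by
  refine Subgroup.isMulCommutative_closure ?_
  rintro _ ⟨x, y, rfl⟩ _ ⟨z, w, rfl⟩
  have h := congrArg (·⁻¹) (hQ.act'_mul_inv_mul y x w)
  simp only [mul_inv_rev, inv_inv] at h
  calc _ = (Rack.act' x * (Rack.act' y)⁻¹ * Rack.act' z : Equiv.Perm Q) * (Rack.act' w)⁻¹ := by
        group
    _ = Rack.act' z * ((Rack.act' y)⁻¹ * (Rack.act' x * (Rack.act' w)⁻¹)) := by
        rw [hQ.act'_mul_inv_mul]; group
    _ = _ := by rw [← h]; group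

/-- Needed so that conjugation by the translation at the base point can serve as the action of `t`;
the inverse conjugation below serves as `t⁻¹`. -/
theorem conj_mem_displacement {Q : Type*} [Quandle Q] (q : Q) {g : Equiv.Perm Q}
    (hg : g ∈ displacement Q) : Rack.act' q * g * (Rack.act' q)⁻¹ ∈ displacement Q := by
  induction hg using Subgroup.closure_induction with
  | mem g hg =>
    obtain ⟨x, y, rfl⟩ := hg
    refine Subgroup.subset_closure ⟨Shelf.act q x, Shelf.act q y, ?_⟩
    rw [Rack.ad_conj, Rack.ad_conj]
    group
  | one => simp [one_mem]
  | mul a b _ _ ha hb => simpa [mul_assoc] using mul_mem ha hb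
  | inv a _ ha => simpa [mul_assoc] using inv_mem ha

theorem inv_conj_mem_displacement {Q : Type*} [Quandle Q] (q : Q) {g : Equiv.Perm Q}
    (hg : g ∈ displacement Q) : (Rack.act' q)⁻¹ * g * Rack.act' q ∈ displacement Q := by
  induction hg using Subgroup.closure_induction with
  | mem g hg =>
    obtain ⟨x, y, rfl⟩ := hg
    refine Subgroup.subset_closure ⟨Rack.invAct q x, Rack.invAct q y, ?_⟩
    have key : ∀ z : Q, (Rack.act' (Rack.invAct q z) : Equiv.Perm Q) =
        (Rack.act' q)⁻¹ * Rack.act' z * Rack.act' q := by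
      intro z
      have h := Rack.ad_conj q (Rack.invAct q z)
      rw [Rack.right_inv] at h
      rw [h]
      group
    rw [key, key]
    group
  | one => simp [one_mem]
  | mul a b _ _ ha hb => simpa [mul_assoc] using mul_mem ha hb
  | inv a _ ha => simpa [mul_assoc] using inv_mem ha

/-- A quandle is connected if its displacement group acts transitively. -/
def IsConnected (Q : Type*) [Quandle Q] : Prop :=
  ∀ x y : Q, ∃ g ∈ displacement Q, g x = y

/-- Since `β_x` fixes `x`, the quotient `β_y β_x⁻¹` moves `x` as `β_y` does. -/
theorem act_eq_displacement {Q : Type*} [Quandle Q] (x y : Q) :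
    ∃ g ∈ displacement Q, g x = Shelf.act y x :=
  ⟨Rack.act' y * (Rack.act' x)⁻¹, Subgroup.subset_closure ⟨y, x, rfl⟩, by
    have h : (Rack.act' x)⁻¹ x = x := by
      rw [Equiv.Perm.inv_eq_iff_eq]
      exact (Quandle.fix).symm
    rw [Equiv.Perm.mul_apply, h, Rack.act'_apply]⟩

/-- Translations are quandle automorphisms by self-distributivity, hence so are displacements, and
an automorphism conjugates translations to translations. -/
theorem act'_displacement {Q : Type*} [Quandle Q] {g : Equiv.Perm Q} (hg : g ∈ displacement Q)
    (x : Q) : (Rack.act' (g x) : Equiv.Perm Q) = g * Rack.act' x * g⁻¹ := by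
  induction hg using Subgroup.closure_induction generalizing x with
  | mem g hg =>
    obtain ⟨y, z, rfl⟩ := hg
    have h : (Rack.act' ((Rack.act' z)⁻¹ x) : Equiv.Perm Q) =
        (Rack.act' z)⁻¹ * Rack.act' x * Rack.act' z := by
      have h := Rack.ad_conj z ((Rack.act' z)⁻¹ x)
      rw [← Rack.act'_apply,
        show Rack.act' z ((Rack.act' z)⁻¹ x) = x from Equiv.apply_symm_apply _ _] at h
      rw [h]
      group
    rw [Equiv.Perm.mul_apply, Rack.act'_apply, Rack.ad_conj, h]
    group
  | one => simp
  | mul a b _ _ ha hb =>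
    rw [Equiv.Perm.mul_apply, ha, hb]
    group
  | inv a _ ha =>
    have h := ha (a⁻¹ x)
    rw [show a (a⁻¹ x) = x from Equiv.apply_symm_apply _ _] at h
    rw [h]
    group

/-- A connected medial quandle is a standard Alexander quandle, with any given base point at the
origin. -/
theorem IsMedial.exists_alexander.{u} {Q : Type u} [Quandle Q] (hQ : IsMedial Q) (hc : IsConnected Q)
    (q : Q) : ∃ (N : Type u) (_ : AddCommGroup N) (_ : Module LaurentRing N) (e : N → Q),
      Function.Bijective e ∧ e 0 = q ∧
        ∀ x y : N, e (AlexanderQuandle.op x y) = Shelf.act (e y) (e x) := by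
  let _ := hQ.displacement_comm
  let _ : CommGroup (displacement Q) :=
    { (inferInstance : Group (displacement Q)) with mul_comm := mul_comm' }
  let u : (AddMonoid.End (Additive (displacement Q)))ˣ :=
    { val :=
        { toFun := fun g => Additive.ofMul ⟨_, conj_mem_displacement q g.toMul.2⟩
          map_zero' := by
            apply Additive.toMul.injective; apply Subtype.ext; simp
          map_add' := fun a b => by
            apply Additive.toMul.injective; apply Subtype.ext; simp [mul_assoc] }
      inv :=
        { toFun := fun g => Additive.ofMul ⟨_, inv_conj_mem_displacement q g.toMul.2⟩
          map_zero' := by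
            apply Additive.toMul.injective; apply Subtype.ext; simp
          map_add' := fun a b => by
            apply Additive.toMul.injective; apply Subtype.ext; simp [mul_assoc] }
      val_inv := by
        refine AddMonoidHom.ext fun g => Additive.toMul.injective (Subtype.ext ?_)
        change Rack.act' q * ((Rack.act' q)⁻¹ * (g.toMul : Equiv.Perm Q) * Rack.act' q) *
          (Rack.act' q)⁻¹ = (g.toMul : Equiv.Perm Q)
        simp [mul_assoc]
      inv_val := by
        refine AddMonoidHom.ext fun g => Additive.toMul.injective (Subtype.ext ?_)
        change (Rack.act' q)⁻¹ * (Rack.act' q * (g.toMul : Equiv.Perm Q) * (Rack.act' q)⁻¹) *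
          Rack.act' q = (g.toMul : Equiv.Perm Q)
        simp [mul_assoc] }
  let _ := LaurentRing.moduleOfUnit u
  refine ⟨Additive (displacement Q), inferInstance, inferInstance,
    fun g => (g.toMul : Equiv.Perm Q) q, ⟨?_, ?_⟩, rfl, ?_⟩
  · intro g h hgh
    apply Additive.toMul.injective
    ext x
    -- A transitive abelian group acts freely: `g` and `h` commute with `k`, so agreement at `q`
    -- spreads to `k q`.
    obtain ⟨k, hk, rfl⟩ := hc q x
    have hcomm : ∀ a : displacement Q, (a : Equiv.Perm Q) (k q) = k ((a : Equiv.Perm Q) q) :=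
      fun a => DFunLike.congr_fun (congrArg Subtype.val (mul_comm' a ⟨k, hk⟩)) q
    rw [hcomm, hcomm]
    exact congrArg k hgh
  · intro x
    obtain ⟨g, hg, rfl⟩ := hc q x
    exact ⟨Additive.ofMul ⟨g, hg⟩, rfl⟩
  · intro x y
    have hop : AlexanderQuandle.op x y =
        y + (u : AddMonoid.End (Additive (displacement Q))) (x - y) := by
      rw [← LaurentRing.moduleOfUnit_T_smul, AlexanderQuandle.op]
      module
    rw [hop]
    have hq : (Rack.act' q)⁻¹ q = q := by
      rw [Equiv.Perm.inv_eq_iff_eq]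
      exact (Quandle.fix).symm
    have hxy : (x - y).toMul = y.toMul⁻¹ * x.toMul := by
      rw [sub_eq_neg_add]; rfl
    -- In multiplicative form the left side is `y β_q y⁻¹ x β_q⁻¹` at `q`. Here `β_q⁻¹` fixes `q`,
    -- and `y β_q y⁻¹` is the translation by `y q`.
    change ((y.toMul : Equiv.Perm Q) * (Rack.act' q * ((x - y).toMul : Equiv.Perm Q) *
      (Rack.act' q)⁻¹)) q = Rack.act' ((y.toMul : Equiv.Perm Q) q) ((x.toMul : Equiv.Perm Q) q)
    rw [act'_displacement y.toMul.2, hxy]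
    simp

end Quandle

/-! ### Walking along a knot diagram from arc to arc -/

namespace CurveParam

theorem shift_shift {μ : ℕ} (p : CurveParam μ) (x y : ℝ) :
    (p.shift x).shift y = p.shift (x + y) := by
  simp [shift, add_assoc]

theorem exists_shift_eq (p q : CurveParam 1) : ∃ x : ℝ, p.shift x = q := by
  obtain ⟨x, hx⟩ := QuotientAddGroup.mk_surjective (q.2 - p.2)
  refine ⟨x, Prod.ext (Subsingleton.elim _ _) ?_⟩
  change p.2 + (QuotientAddGroup.mk x) = q.2
  rw [hx, add_sub_cancel]

end CurveParam

namespace VirtualLinkDiagram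

/-- The parameter `p` lies on an arc of the set `S`. -/
def OnArc {μ : ℕ} (D : VirtualLinkDiagram μ) (S : Set D.Arc) (p : CurveParam μ) : Prop :=
  ∃ h : p ∉ Set.range D.underParam, (ConnectedComponents.mk (⟨p, h⟩ : D.CutParam)) ∈ S

theorem eventually_onArc_of_eventually {μ : ℕ} (D : VirtualLinkDiagram μ) {p : CurveParam μ}
    {a : D.Arc} {S : Set D.Arc} (ha : a ∈ S) {l : Filter ℝ}
    (h : ∀ᶠ x in l, ∃ h : p.shift x ∉ Set.range D.underParam,
      (ConnectedComponents.mk (⟨p.shift x, h⟩ : D.CutParam)) = a) :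
    ∀ᶠ x in l, D.OnArc S (p.shift x) := by
  filter_upwards [h] with x ⟨hx, hxa⟩
  exact ⟨hx, hxa ▸ ha⟩

theorem eventually_onArc_of_mem {μ : ℕ} (D : VirtualLinkDiagram μ) {S : Set D.Arc}
    {p : D.CutParam} (hp : ConnectedComponents.mk p ∈ S) :
    ∀ᶠ x in nhdsWithin (0 : ℝ) {0}ᶜ, D.OnArc S (p.1.shift x) := by
  obtain ⟨ε, hε, h⟩ := D.exists_forall_shift_not_mem p.1
  have h0 : p.1.shift 0 = p.1 := by simp [CurveParam.shift]
  obtain ⟨a, ha⟩ := D.exists_arc_of_isPreconnected p.1 (Set.Ioo (-ε) ε) isPreconnected_Ioo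
    (Set.nonempty_Ioo.2 (by linarith)) (fun x hx => by
      rcases eq_or_ne x 0 with rfl | hx0
      · rw [h0]; exact p.2
      · exact h x hx0 (abs_lt.2 hx))
  obtain ⟨k, hk⟩ := ha 0 ⟨by linarith, hε⟩
  have hpa : ConnectedComponents.mk p = a := by
    rw [← hk]
    congr 1
    exact Subtype.ext h0.symm
  exact D.eventually_onArc_of_eventually (hpa ▸ hp)
    (nhdsWithin_le_nhds (Filter.mem_of_superset (Ioo_mem_nhds (by linarith) hε) ha))

/-- Away from the cuts a single arc surrounds `p`; at a cut, the arcs before and after are both in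
`S` or both outside. Punctured neighbourhoods are used because a cut point lies on no arc. -/
theorem eventually_onArc_or {μ : ℕ} (D : VirtualLinkDiagram μ) {S : Set D.Arc}
    (hS : ∀ c, D.arcBefore c ∈ S ↔ D.arcAfter c ∈ S) (p : CurveParam μ) :
    (∀ᶠ x in nhdsWithin (0 : ℝ) {0}ᶜ, D.OnArc S (p.shift x)) ∨
      ∀ᶠ x in nhdsWithin (0 : ℝ) {0}ᶜ, D.OnArc Sᶜ (p.shift x) := by
  by_cases hp : p ∈ Set.range D.underParam
  · obtain ⟨c, rfl⟩ := hp
    have hb := (D.exists_arcBefore (D.underParam c)).choose_spec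
    have ha := (D.exists_arcAfter (D.underParam c)).choose_spec
    rw [← nhdsLT_sup_nhdsGT, Filter.eventually_sup, Filter.eventually_sup]
    by_cases h : D.arcBefore c ∈ S
    · exact Or.inl ⟨D.eventually_onArc_of_eventually h hb,
        D.eventually_onArc_of_eventually ((hS c).1 h) ha⟩
    · exact Or.inr ⟨D.eventually_onArc_of_eventually (S := Sᶜ) h hb,
        D.eventually_onArc_of_eventually (S := Sᶜ) (fun h' => h ((hS c).2 h')) ha⟩
  · by_cases h : ConnectedComponents.mk (⟨p, hp⟩ : D.CutParam) ∈ S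
    · exact Or.inl (D.eventually_onArc_of_mem h)
    · exact Or.inr (D.eventually_onArc_of_mem (S := Sᶜ) h)

theorem isOpen_setOf_eventually_onArc {μ : ℕ} (D : VirtualLinkDiagram μ) (S : Set D.Arc)
    (p : CurveParam μ) :
    IsOpen {x : ℝ | ∀ᶠ y in nhdsWithin (0 : ℝ) {0}ᶜ, D.OnArc S ((p.shift x).shift y)} := by
  have hiff : ∀ x : ℝ, (∀ᶠ y in nhdsWithin (0 : ℝ) {0}ᶜ, D.OnArc S ((p.shift x).shift y)) ↔
      ∀ᶠ y in nhdsWithin x {x}ᶜ, D.OnArc S (p.shift y) := by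
    intro x
    simp only [CurveParam.shift_shift]
    have h := (Homeomorph.addLeft x).isEmbedding.map_nhdsWithin_eq {0}ᶜ 0
    rw [Set.image_compl_eq (Homeomorph.addLeft x).bijective] at h
    simp only [Homeomorph.coe_addLeft, add_zero, Set.image_singleton] at h
    rw [← h, Filter.eventually_map]
  simp only [hiff]
  refine isOpen_iff_mem_nhds.2 fun x hx => ?_
  have h := eventually_nhdsNE_eventually_nhds_iff.2 hx
  rw [eventually_nhdsWithin_iff] at h
  filter_upwards [h] with y hy
  rcases eq_or_ne y x with rfl | hne
  · exact hx
  · exact (hy hne).filter_mono nhdsWithin_le_nhds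

/-- Any two arcs of a knot diagram are joined by a sequence of arcs in which consecutive arcs meet
at an underpass. -/
theorem arc_mem_of_mem (D : VirtualKnotDiagram) {S : Set D.Arc}
    (hS : ∀ c, D.arcBefore c ∈ S ↔ D.arcAfter c ∈ S) {a b : D.Arc} (ha : a ∈ S) : b ∈ S := by
  obtain ⟨p, rfl⟩ := ConnectedComponents.surjective_coe a
  obtain ⟨q, rfl⟩ := ConnectedComponents.surjective_coe b
  by_contra hb
  have hpos := D.isOpen_setOf_eventually_onArc S p.1
  have hneg := D.isOpen_setOf_eventually_onArc Sᶜ p.1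
  obtain ⟨z, hz⟩ := CurveParam.exists_shift_eq p.1 q.1
  -- The line covers the only circle of a knot. It is connected, so the two open sets that cover it,
  -- both nonempty, meet; near a common point some parameter would lie on an arc both in `S` and
  -- outside.
  obtain ⟨x, -, hx, hx'⟩ := isPreconnected_univ _ _ hpos hneg
    (fun x _ => D.eventually_onArc_or hS (p.1.shift x))
    ⟨0, trivial, by simpa [CurveParam.shift] using D.eventually_onArc_of_mem ha⟩
    ⟨z, trivial, by
      simpa only [Set.mem_ofPred_eq, hz] using D.eventually_onArc_of_mem (S := Sᶜ) hb⟩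
  rw [Set.mem_ofPred_eq] at hx hx'
  obtain ⟨y, ⟨_, h⟩, ⟨_, h'⟩⟩ := (hx.and hx').exists
  exact h' h

/-- The direction of the underpass decides which side comes first, but the closure condition is
symmetric in the two sides. -/
theorem arc_mem_of_rightArc_iff (D : VirtualKnotDiagram) {S : Set D.Arc}
    (hS : ∀ c, D.rightArc c ∈ S ↔ D.leftArc c ∈ S) {a b : D.Arc} (ha : a ∈ S) : b ∈ S := by
  refine D.arc_mem_of_mem (fun c => ?_) ha
  have h := hS c
  unfold rightArc leftArc at h
  split_ifs at h
  · exact h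
  · exact h.symm

theorem nonempty_arc (D : VirtualKnotDiagram) : Nonempty D.Arc :=
  ⟨(D.exists_arcBefore (0, 0)).choose⟩

end VirtualLinkDiagram

/-! ### Homomorphisms of quandles and linearity for Alexander quandles -/

theorem ShelfHom.map_invAct {Q Q' : Type*} [Quandle Q] [Quandle Q'] (f : ShelfHom Q Q') (x y : Q) :
    f (Rack.invAct x y) = Rack.invAct (f x) (f y) := by
  apply (Rack.act' (f x)).injective
  rw [Rack.act'_apply, Rack.act'_apply, Rack.right_inv, ← ShelfHom.map_act, Rack.right_inv]

namespace Quandle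

theorem Isomorphic.symm {Q Q' : Type*} [Quandle Q] [Quandle Q'] (h : Isomorphic Q Q') :
    Isomorphic Q' Q := by
  obtain ⟨f, hf⟩ := h
  let e := Equiv.ofBijective f hf
  refine ⟨⟨e.symm, fun {x y} => ?_⟩, e.symm.bijective⟩
  apply e.injective
  rw [e.apply_symm_apply]
  change _ = f _
  rw [ShelfHom.map_act]
  exact congrArg₂ Shelf.act (e.apply_symm_apply x).symm (e.apply_symm_apply y).symm

theorem Isomorphic.trans {Q Q' Q'' : Type*} [Quandle Q] [Quandle Q'] [Quandle Q'']
    (h : Isomorphic Q Q') (h' : Isomorphic Q' Q'') : Isomorphic Q Q'' := by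
  obtain ⟨f, hf⟩ := h
  obtain ⟨g, hg⟩ := h'
  exact ⟨g.comp f, hg.comp hf⟩

end Quandle

namespace AlexanderQuandle

theorem map_op {N N' : Type*} [AddCommGroup N] [Module LaurentRing N] [AddCommGroup N']
    [Module LaurentRing N'] (f : N →ₗ[LaurentRing] N') (x y : N) :
    f (op x y) = op (f x) (f y) := by
  simp only [op, map_add, map_smul]

theorem op_sub_right {N : Type*} [AddCommGroup N] [Module LaurentRing N] (x y z : N) :
    op (x - z) (y - z) = op x y - z := by
  unfold op
  module

theorem op_medial {N : Type*} [AddCommGroup N] [Module LaurentRing N] (w x y z : N) :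
    op (op w x) (op y z) = op (op w y) (op x z) := by
  unfold op
  module

theorem isomorphic_of_linearEquiv {N N' : Type*} [AddCommGroup N] [Module LaurentRing N]
    [AddCommGroup N'] [Module LaurentRing N'] (e : N ≃ₗ[LaurentRing] N') :
    Quandle.Isomorphic (AlexanderQuandle N) (AlexanderQuandle N') := by
  refine ⟨⟨(e : N → N'), fun {x y} => ?_⟩, e.bijective⟩
  exact map_op (N := N) e.toLinearMap y x

/-- If `1 - t` maps a module onto itself, then the maps from its standard Alexander quandle to
another one that preserve the operation and the origin are linear. -/
theorem exists_linearMap {N N' : Type*} [AddCommGroup N] [Module LaurentRing N]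
    [AddCommGroup N'] [Module LaurentRing N']
    (hN : ∀ x : N, ∃ y : N, (1 - LaurentPolynomial.T 1 : LaurentRing) • y = x) (f : N → N')
    (h0 : f 0 = 0) (hf : ∀ x y, f (op x y) = op (f x) (f y)) :
    ∃ g : N →ₗ[LaurentRing] N', ∀ x, g x = f x := by
  have ht : ∀ x, f ((LaurentPolynomial.T 1 : LaurentRing) • x) =
      (LaurentPolynomial.T 1 : LaurentRing) • f x := by
    intro x
    simpa [op, h0] using hf x 0
  have hs : ∀ x, f ((1 - LaurentPolynomial.T 1 : LaurentRing) • x) =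
      (1 - LaurentPolynomial.T 1 : LaurentRing) • f x := by
    intro x
    simpa only [op, h0, smul_zero, zero_add] using hf 0 x
  have hadd : ∀ x y, f (x + y) = f x + f y := by
    intro x y
    obtain ⟨y, rfl⟩ := hN y
    -- Now `x + (1 - t) y` is the quandle product of `t⁻¹ x` and `y`, which `f` preserves.
    have hx : (LaurentPolynomial.T 1 : LaurentRing) •
        (LaurentPolynomial.T (-1) : LaurentRing) • x = x := by
      rw [smul_smul, ← LaurentPolynomial.T_add]; simp
    rw [hs, ← hx, ht]
    exact hf _ y
  let g : N →+ N' := ⟨⟨f, h0⟩, hadd⟩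
  exact ⟨⟨g.toAddHom, g.map_laurent_smul ht⟩, fun _ => rfl⟩

/-- If `1 - t` maps a module onto itself, then its standard Alexander quandle determines it. -/
theorem nonempty_linearEquiv_of_isomorphic {N N' : Type*} [AddCommGroup N] [Module LaurentRing N]
    [AddCommGroup N'] [Module LaurentRing N']
    (hN : ∀ x : N, ∃ y : N, (1 - LaurentPolynomial.T 1 : LaurentRing) • y = x)
    (h : Quandle.Isomorphic (AlexanderQuandle N) (AlexanderQuandle N')) :
    Nonempty (N ≃ₗ[LaurentRing] N') := by
  obtain ⟨F, hF⟩ := h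
  let F' : N → N' := F
  have hop : ∀ x y : N, F' (op x y) = op (F' x) (F' y) := fun x y => F.map_act' (x := y) (y := x)
  -- Translations of the module preserve the operation, so the isomorphism may be recentred to fix
  -- the origin.
  obtain ⟨g, hg⟩ := exists_linearMap hN (fun x => F' x - F' 0) (sub_self _) (by
    intro x y
    rw [op_sub_right, hop])
  have hb : Function.Bijective fun x => F' x - F' 0 :=
    (Equiv.subRight (F' 0)).bijective.comp hF
  exact ⟨LinearEquiv.ofBijective g ((funext hg : (g : N → N') = _) ▸ hb)⟩

theorem isMedial (N : Type*) [AddCommGroup N] [Module LaurentRing N] :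
    Quandle.IsMedial (AlexanderQuandle N) := by
  intro w x y z
  exact op_medial (N := N) w x y z

end AlexanderQuandle

/-! ### The universal property of a presented medial quandle -/

namespace MedialQuandle

/-- The value of an expression in a quandle. -/
def Term.eval {A Q : Type*} [Quandle Q] (f : A → Q) : Term A → Q
  | .gen a => f a
  | .op x y => Shelf.act (y.eval f) (x.eval f)
  | .inv x y => Rack.invAct (y.eval f) (x.eval f)

theorem Congruence.eval_eq {A Q : Type*} [Quandle Q] (hQ : Quandle.IsMedial Q)
    {rels : Term A → Term A → Prop} (f : A → Q) (hf : ∀ x y, rels x y → x.eval f = y.eval f)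
    {x y : Term A} (h : Congruence rels x y) : x.eval f = y.eval f := by
  induction h with
  | rel h => exact hf _ _ h
  | refl => rfl
  | symm _ h => exact h.symm
  | trans _ _ h k => exact h.trans k
  | op_congr _ _ h k => simp only [Term.eval, h, k]
  | inv_congr _ _ h k => simp only [Term.eval, h, k]
  | idem => exact Quandle.fix
  | inv_op => exact Rack.left_inv _ _
  | op_inv => exact Rack.right_inv _ _
  | medial => exact hQ _ _ _ _

/-- The homomorphism from a presented medial quandle given by the images of the generators. -/
def Presented.lift {A Q : Type*} [Quandle Q] (hQ : Quandle.IsMedial Q)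
    {rels : Term A → Term A → Prop} (f : A → Q) (hf : ∀ x y, rels x y → x.eval f = y.eval f) :
    ShelfHom (Presented rels) Q where
  toFun := Quotient.lift (s := congruenceSetoid rels) (Term.eval f)
    fun _ _ h => Congruence.eval_eq hQ f hf h
  map_act' := by
    rintro ⟨x⟩ ⟨y⟩
    rfl

theorem Presented.hom_ext {A Q : Type*} [Quandle Q] {rels : Term A → Term A → Prop}
    {f g : ShelfHom (Presented rels) Q}
    (h : ∀ a, f (Presented.mk rels (.gen a)) = g (Presented.mk rels (.gen a)))
    (x : Presented rels) : f x = g x := by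
  obtain ⟨x, rfl⟩ := Quotient.exists_rep x
  change f (Presented.mk rels x) = g (Presented.mk rels x)
  induction x with
  | gen a => exact h a
  | op x y hx hy =>
    change f (Shelf.act (Presented.mk rels y) (Presented.mk rels x)) =
      g (Shelf.act (Presented.mk rels y) (Presented.mk rels x))
    rw [ShelfHom.map_act, ShelfHom.map_act, hx, hy]
  | inv x y hx hy =>
    change f (Rack.invAct (Presented.mk rels y) (Presented.mk rels x)) =
      g (Rack.invAct (Presented.mk rels y) (Presented.mk rels x))
    rw [ShelfHom.map_invAct, ShelfHom.map_invAct, hx, hy]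

open Quandle in
/-- Every element of a presented medial quandle is in the orbit of a generator. -/
theorem Presented.exists_displacement_gen {A : Type*} (rels : Term A → Term A → Prop)
    (x : Presented rels) :
    ∃ a, ∃ g ∈ displacement (Presented rels), g (Presented.mk rels (.gen a)) = x := by
  obtain ⟨x, rfl⟩ := Quotient.exists_rep x
  change ∃ a, ∃ g ∈ displacement (Presented rels), _ = Presented.mk rels x
  induction x with
  | gen a => exact ⟨a, 1, one_mem _, rfl⟩
  | op x y hx _ =>
    obtain ⟨a, g, hg, h⟩ := hx
    obtain ⟨k, hk, h'⟩ := act_eq_displacement (Presented.mk rels x) (Presented.mk rels y)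
    exact ⟨a, k * g, mul_mem hk hg, by rw [Equiv.Perm.mul_apply, h, h']; rfl⟩
  | inv x y hx _ =>
    obtain ⟨a, g, hg, h⟩ := hx
    -- Some displacement `k` carries `x ▷⁻¹ y` to `x`, so `k⁻¹` leads back.
    obtain ⟨k, hk, h'⟩ := act_eq_displacement
      (Rack.invAct (Presented.mk rels y) (Presented.mk rels x)) (Presented.mk rels y)
    rw [Rack.right_inv] at h'
    refine ⟨a, k⁻¹ * g, mul_mem (inv_mem hk) hg, ?_⟩
    rw [Equiv.Perm.mul_apply, h, Equiv.Perm.inv_eq_iff_eq]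
    exact h'.symm

end MedialQuandle

/-! ### The medial quandle of a knot and its Alexander invariant -/

namespace VirtualLinkDiagram

open MedialQuandle Quandle

/-- The generator of the medial quandle given by an arc. -/
def quandleGen {μ : ℕ} (D : VirtualLinkDiagram μ) (a : D.Arc) : D.MQ :=
  Presented.mk D.CrossingRelation (.gen a)

theorem quandleGen_leftArc {μ : ℕ} (D : VirtualLinkDiagram μ) (c : D.Crossing) :
    D.quandleGen (D.leftArc c) =
      Shelf.act (D.quandleGen (D.overArc c)) (D.quandleGen (D.rightArc c)) :=
  Quotient.sound (s := congruenceSetoid D.CrossingRelation) (.rel ⟨c, rfl, rfl⟩)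

/-- A crossing relation puts its two underpassing generators into one orbit. Walking along the
single component joins all generators, and every element is in the orbit of one. -/
theorem isConnected_MQ (D : VirtualKnotDiagram) : IsConnected D.MQ := by
  have hgen : ∀ a b, ∃ g ∈ displacement D.MQ, g (D.quandleGen a) = D.quandleGen b := by
    intro a b
    refine D.arc_mem_of_rightArc_iff (a := a)
      (S := {b | ∃ g ∈ displacement D.MQ, g (D.quandleGen a) = D.quandleGen b})
      (fun c => ?_) ⟨1, one_mem _, rfl⟩
    obtain ⟨k, hk, h⟩ := act_eq_displacement (D.quandleGen (D.rightArc c))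
      (D.quandleGen (D.overArc c))
    rw [← D.quandleGen_leftArc] at h
    constructor
    · rintro ⟨g, hg, h'⟩
      exact ⟨k * g, mul_mem hk hg, by rw [Equiv.Perm.mul_apply, h', h]⟩
    · rintro ⟨g, hg, h'⟩
      refine ⟨k⁻¹ * g, mul_mem (inv_mem hk) hg, ?_⟩
      rw [Equiv.Perm.mul_apply, h', Equiv.Perm.inv_eq_iff_eq, h]
  intro x y
  obtain ⟨a, g, hg, rfl⟩ := Presented.exists_displacement_gen _ x
  obtain ⟨b, k, hk, rfl⟩ := Presented.exists_displacement_gen _ y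
  obtain ⟨l, hl, h⟩ := hgen a b
  refine ⟨k * l * g⁻¹, mul_mem (mul_mem hk hl) (inv_mem hg), ?_⟩
  rw [Equiv.Perm.mul_apply, Equiv.Perm.mul_apply,
    show g⁻¹ (g _) = _ from Equiv.symm_apply_apply _ _]
  exact congrArg k h

/-- The generator of the reduced Alexander module given by an arc. -/
noncomputable def moduleGen {μ : ℕ} (D : VirtualLinkDiagram μ) (a : D.Arc) :
    D.ReducedAlexanderModule :=
  (LinearMap.range D.crossingMap).mkQ (Finsupp.single a 1)

theorem phiRed_moduleGen {μ : ℕ} (D : VirtualLinkDiagram μ) (a : D.Arc) :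
    D.phiRed (D.moduleGen a) = 1 := by
  simp [phiRed, moduleGen]

theorem moduleGen_leftArc {μ : ℕ} (D : VirtualLinkDiagram μ) (c : D.Crossing) :
    D.moduleGen (D.leftArc c) =
      AlexanderQuandle.op (D.moduleGen (D.rightArc c)) (D.moduleGen (D.overArc c)) := by
  have h : (LinearMap.range D.crossingMap).mkQ (D.crossingMap (Finsupp.single c 1)) = 0 := by
    rw [Submodule.mkQ_apply, Submodule.Quotient.mk_eq_zero]
    exact ⟨_, rfl⟩
  rw [crossingMap, Finsupp.linearCombination_single, one_smul, map_sub, map_add, map_smul,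
    map_smul, sub_eq_zero] at h
  rw [AlexanderQuandle.op, add_comm]
  exact h.symm

/-- A linear map from the reduced Alexander module given by the images of the generators. -/
theorem exists_moduleLift {μ : ℕ} (D : VirtualLinkDiagram μ) {N : Type*} [AddCommGroup N]
    [Module LaurentRing N] (f : D.Arc → N)
    (hf : ∀ c, f (D.leftArc c) = AlexanderQuandle.op (f (D.rightArc c)) (f (D.overArc c))) :
    ∃ g : D.ReducedAlexanderModule →ₗ[LaurentRing] N, ∀ a, g (D.moduleGen a) = f a := by
  suffices h : LinearMap.range D.crossingMap ≤
      LinearMap.ker (Finsupp.linearCombination LaurentRing f) from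
    ⟨(LinearMap.range D.crossingMap).liftQ _ h, fun a => by simp [moduleGen]⟩
  rw [LinearMap.range_le_ker_iff]
  ext c
  simp only [crossingMap, LinearMap.comp_apply, Finsupp.lsingle_apply,
    Finsupp.linearCombination_single, one_smul, map_sub, map_add, map_smul, hf,
    AlexanderQuandle.op, LinearMap.zero_apply]
  abel

/-- If `x` is the sum of `r_a` times the generator of `a`, then `φ x` is the sum of the `r_a`, so
the difference is the sum of `r_a` times generator differences. -/
theorem sub_phiRed_smul_mem {μ : ℕ} (D : VirtualLinkDiagram μ) (b : D.Arc)
    (P : Submodule LaurentRing D.ReducedAlexanderModule)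
    (hP : ∀ a, D.moduleGen a - D.moduleGen b ∈ P) (x : D.ReducedAlexanderModule) :
    x - D.phiRed x • D.moduleGen b ∈ P := by
  obtain ⟨x, rfl⟩ := Submodule.mkQ_surjective _ x
  induction x using Finsupp.induction_linear with
  | zero => simp
  | add x y hx hy =>
    rw [map_add, map_add, add_smul, add_sub_add_comm]
    exact P.add_mem hx hy
  | single a r =>
    have h : (LinearMap.range D.crossingMap).mkQ (Finsupp.single a r) = r • D.moduleGen a := by
      rw [moduleGen, ← map_smul, Finsupp.smul_single_one]
    rw [h, map_smul, phiRed_moduleGen, smul_eq_mul, mul_one, ← smul_sub]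
    exact P.smul_mem _ (hP a)

/-- The difference of two generators, in the Alexander invariant. -/
noncomputable def genDiff {μ : ℕ} (D : VirtualLinkDiagram μ) (a b : D.Arc) :
    D.AlexanderInvariant :=
  ⟨D.moduleGen a - D.moduleGen b, by
    rw [LinearMap.mem_ker, map_sub, phiRed_moduleGen, phiRed_moduleGen, sub_self]⟩

/-- On the kernel the correction term `φ x` vanishes; hence the differences with one fixed generator
span it. -/
theorem mem_of_genDiff_mem {μ : ℕ} (D : VirtualLinkDiagram μ) (b : D.Arc)
    (P : Submodule LaurentRing D.AlexanderInvariant) (hP : ∀ a, D.genDiff a b ∈ P)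
    (x : D.AlexanderInvariant) : x ∈ P := by
  have h := D.sub_phiRed_smul_mem b (P.map (LinearMap.ker D.phiRed).subtype)
    (fun a => ⟨_, hP a, rfl⟩) x
  rw [LinearMap.mem_ker.1 x.2, zero_smul, sub_zero] at h
  obtain ⟨y, hy, hyx⟩ := h
  exact (Subtype.ext hyx : y = x) ▸ hy

/-- The operation commutes with subtracting a constant, so the differences inherit the crossing
relations; they are to be the images of the quandle generators. -/
theorem genDiff_leftArc {μ : ℕ} (D : VirtualLinkDiagram μ) (c : D.Crossing) (b : D.Arc) :
    D.genDiff (D.leftArc c) b =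
      AlexanderQuandle.op (D.genDiff (D.rightArc c) b) (D.genDiff (D.overArc c) b) := by
  apply Subtype.ext
  change D.moduleGen (D.leftArc c) - _ = AlexanderQuandle.op
    (D.moduleGen (D.rightArc c) - D.moduleGen b) (D.moduleGen (D.overArc c) - D.moduleGen b)
  rw [moduleGen_leftArc, AlexanderQuandle.op_sub_right]

/-- For a knot, `1 - t` maps the Alexander invariant onto itself. -/
theorem exists_one_sub_smul_eq (D : VirtualKnotDiagram) (x : D.AlexanderInvariant) :
    ∃ y, (1 - LaurentPolynomial.T 1 : LaurentRing) • y = x := by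
  obtain ⟨b⟩ := D.nonempty_arc
  let P := LinearMap.range (LinearMap.lsmul LaurentRing D.AlexanderInvariant
    (1 - LaurentPolynomial.T 1))
  refine D.mem_of_genDiff_mem b P (fun a => ?_) x
  -- Modulo the image of `1 - t` the right and left arcs of a crossing agree, so every difference is
  -- congruent to that of `b` with itself, which is zero.
  refine D.arc_mem_of_rightArc_iff (S := {a | D.genDiff a b ∈ P}) (fun c => ?_) (a := b) ?_
  · have h : D.genDiff (D.leftArc c) b = D.genDiff (D.rightArc c) b +
        (1 - LaurentPolynomial.T 1 : LaurentRing) •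
          (D.genDiff (D.overArc c) b - D.genDiff (D.rightArc c) b) := by
      rw [genDiff_leftArc, AlexanderQuandle.op]
      module
    rw [Set.mem_ofPred_eq, Set.mem_ofPred_eq, h]
    exact (Submodule.add_mem_iff_left P ⟨_, rfl⟩).symm
  · have h : D.genDiff b b = 0 := Subtype.ext (sub_self _)
    rw [Set.mem_ofPred_eq, h]
    exact P.zero_mem

/-- The quandle `MQ` is first realised on some module `N`, with `b` at the origin. Then `f` comes
from the quandle presentation and `g` from the module presentation, and `e ∘ g` is the inverse of
`f`. -/
theorem isomorphic_MQ (D : VirtualKnotDiagram) :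
    Isomorphic D.MQ (AlexanderQuandle D.AlexanderInvariant) := by
  obtain ⟨b⟩ := D.nonempty_arc
  obtain ⟨N, _, _, e, he, he0, heop⟩ := (Presented.isMedial D.CrossingRelation).exists_alexander
    D.isConnected_MQ (D.quandleGen b)
  let eh : ShelfHom (AlexanderQuandle N) D.MQ := ⟨e, fun {x y} => heop y x⟩
  let f : ShelfHom D.MQ (AlexanderQuandle D.AlexanderInvariant) :=
    Presented.lift (AlexanderQuandle.isMedial _) (fun a => D.genDiff a b) (by
      rintro _ _ ⟨c, rfl, rfl⟩
      exact D.genDiff_leftArc c b)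
  choose h hh using fun a => he.2 (D.quandleGen a)
  obtain ⟨G, hG⟩ := D.exists_moduleLift h (fun c => by
    apply he.1
    rw [heop, hh, hh, hh, quandleGen_leftArc])
  let g : D.AlexanderInvariant →ₗ[LaurentRing] N := G.domRestrict _
  have hb : h b = 0 := he.1 ((hh b).trans he0.symm)
  have hg : ∀ a, g (D.genDiff a b) = h a := by
    intro a
    change G (D.moduleGen a - D.moduleGen b) = h a
    rw [map_sub, hG, hG, hb, sub_zero]
  let gh : ShelfHom (AlexanderQuandle D.AlexanderInvariant) (AlexanderQuandle N) :=
    ⟨g, fun {x y} => AlexanderQuandle.map_op g y x⟩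
  -- Both sides are quandle homomorphisms that agree on the generators.
  have hleft : ∀ x, e (g (f x)) = x := fun x =>
    Presented.hom_ext (f := eh.comp (gh.comp f)) (g := ShelfHom.id _)
      (fun a => (congrArg e (hg a)).trans (hh a)) x
  have hgsurj : Function.Surjective g := fun x => ⟨f (e x), he.1 (hleft (e x))⟩
  -- Surjectivity of `1 - t` passes to `N`, the image of the invariant under `g`.
  have hN : ∀ x : N, ∃ y : N, (1 - LaurentPolynomial.T 1 : LaurentRing) • y = x := by
    intro x
    obtain ⟨x, rfl⟩ := hgsurj x
    obtain ⟨y, rfl⟩ := D.exists_one_sub_smul_eq x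
    exact ⟨g y, (map_smul g _ y).symm⟩
  have hfgen : ∀ a, f (D.quandleGen a) = D.genDiff a b := fun _ => rfl
  -- Only as a linear map can `f ∘ e` be compared with the inverse of `g` on the spanning
  -- differences, since these are not known to generate the invariant as a quandle.
  obtain ⟨F, hF⟩ := AlexanderQuandle.exists_linearMap (N' := D.AlexanderInvariant) hN
    (fun x => f (e x)) (by
      change f (e 0) = (0 : D.AlexanderInvariant)
      rw [he0, hfgen]
      exact Subtype.ext (sub_self _))
    (fun x y => (congrArg f (heop x y)).trans (f.map_act' (x := e y) (y := e x)))
  have hright : ∀ x, F (g x) = x := by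
    refine D.mem_of_genDiff_mem b (LinearMap.eqLocus (F.comp g) LinearMap.id) fun a => ?_
    change F (g (D.genDiff a b)) = D.genDiff a b
    rw [hF, hg]
    change f (e (h a)) = _
    rw [hh, hfgen]
  exact ⟨f, fun x y hxy => by rw [← hleft x, hxy, hleft],
    fun x => ⟨e (g x), (hF (g x)).symm.trans (hright x)⟩⟩

end VirtualLinkDiagram

theorem mainTheorem3 :
    (∀ D : VirtualKnotDiagram, Quandle.Isomorphic D.MQ (AlexanderQuandle D.AlexanderInvariant)) ∧
    (∀ D D' : VirtualKnotDiagram, Quandle.Isomorphic D.MQ D'.MQ ↔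
      Nonempty (D.AlexanderInvariant ≃ₗ[LaurentRing] D'.AlexanderInvariant)) := by
  refine ⟨fun D => D.isomorphic_MQ, fun D D' => ⟨fun h => ?_, fun ⟨e⟩ => ?_⟩⟩
  · exact AlexanderQuandle.nonempty_linearEquiv_of_isomorphic D.exists_one_sub_smul_eq
      (D.isomorphic_MQ.symm.trans (h.trans D'.isomorphic_MQ))
  · exact D.isomorphic_MQ.trans
      ((AlexanderQuandle.isomorphic_of_linearEquiv e).trans D'.isomorphic_MQ.symm)
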